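/- Let $q$ be a prime power, let $\mathbb{F}_q$ be a finite field with $q$ elements, and let $\mathrm{PGL}(2,q)=\mathrm{GL}(2,\mathbb{F}_q)/Z(\mathrm{GL}(2,\mathbb{F}_q))$. For a non-abelian group $G$ with center $Z(G)$, let $\mathcal{A}_G$ be the non-commuting graph of $G$: its vertex set is $G\setminus Z(G)$, and two distinct vertices $a,b$ are adjacent if and only if $ab\neq ba$. Let $\omega(\mathcal{A}_G)$ denote its clique number, that is, the maximum size of a complete subgraph. Then $$\omega(\mathcal{A}_{\mathrm{PGL}(2,q)})=\begin{cases}4 & \text{if } q=2,\\ 10 & \text{if } q=3,\\ q^2+q+1 & \text{if } q>3.\end{cases}$$ -/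

import Mathlib

/-- The non-commuting graph of a group `G`: the vertices are the non-central elements of `G`,
and two vertices are adjacent exactly when they do not commute
(such vertices are automatically distinct). -/
def nonCommutingGraph (G : Type*) [Group G] :
    SimpleGraph {g : G // g ∉ Subgroup.center G} where
  Adj a b := (a : G) * (b : G) ≠ (b : G) * (a : G)
  symm := ⟨fun _ _ h => h.symm⟩
  loopless := ⟨fun _ h => h rfl⟩

/-! Lifts of commuting elements of `PGL(2, q)` commute up to a scalar, which is a sign by
determinants. Non-scalar matrices commute exactly when they are proportional modulo scalars, i.e.
give the same point of the projective plane of `M₂/scalars`; its `q² + q + 1` points colour the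
graph, bounding cliques. For `q > 3` every point has an invertible lift that anticommutes with no
invertible matrix unless it commutes with it, so the bound is attained. For `q = 2` three points
have no invertible lift (`7 - 3 = 4`); for `q = 3` the six split tori anticommute in pairs (`13 - 3
= 10`). -/

open Matrix Matrix.ProjGenLinGroup

section General

variable {F : Type*} [Field F]

/-- Two matrices commute up to a sign. -/
def SignCommute (A B : Matrix (Fin 2) (Fin 2) F) : Prop :=
  A * B = B * A ∨ A * B = -(B * A)

theorem mk_mul_comm_iff_signCommute (A B : GL (Fin 2) F) :
    mk A * mk B = mk B * mk A ↔ SignCommute A.val B.val := by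
  rw [← map_mul, ← map_mul, mk_eq_mk_iff]
  have hd : (diagonal fun _ => -1 : Matrix (Fin 2) (Fin 2) F) = -1 := by
    rw [← diagonal_one, diagonal_neg]
  constructor
  · rintro ⟨u, hu⟩
    have hdet := congrArg GeneralLinearGroup.det hu
    rw [map_mul, GeneralLinearGroup.det_scalar, map_mul, map_mul, mul_comm (B.det)] at hdet
    have hu2 : u ^ 2 = 1 := by simpa using hdet
    have hu3 : (u : F) ^ 2 = 1 := by rw [← Units.val_pow_eq_pow_val, hu2, Units.val_one]
    have hval := congrArg Units.val hu
    simp only [Units.val_mul, GeneralLinearGroup.coe_scalar] at hval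
    rcases (sq_eq_sq_iff_eq_or_eq_neg.mp (hu3.trans (one_pow 2).symm)) with h | h
    · left; simpa [h] using hval
    · right; rw [← hval]; simp [h, hd]
  · rintro (h | h)
    · exact ⟨1, Units.ext (by simpa using h)⟩
    · refine ⟨-1, Units.ext ?_⟩
      simp [GeneralLinearGroup.coe_scalar, h, hd]

/-- Coordinates of a matrix modulo the scalar matrices. -/
def modScalar (A : Matrix (Fin 2) (Fin 2) F) : Fin 3 → F := ![A 0 0 - A 1 1, A 0 1, A 1 0]

theorem modScalar_ne_zero {A : GL (Fin 2) F} (hA : mk A ∉ Subgroup.center _) :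
    modScalar A.val ≠ 0 := by
  intro h
  have h0 := congrFun h 0
  have h1 := congrFun h 1
  have h2 := congrFun h 2
  simp only [modScalar, Pi.zero_apply, Matrix.cons_val] at h0 h1 h2
  apply hA
  have : mk A = 1 := by
    rw [mk_eq_one, GeneralLinearGroup.mem_center_iff_val_mem_range_scalar]
    refine ⟨A 0 0, ?_⟩
    ext i j
    fin_cases i <;> fin_cases j <;> simp [h1, h2, sub_eq_zero.mp h0]
  rw [this]
  exact one_mem _

theorem commute_of_modScalar_eq_smul {A B : Matrix (Fin 2) (Fin 2) F} (t : F)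
    (h : modScalar A = t • modScalar B) : A * B = B * A := by
  have h0 := congrFun h 0
  have h1 := congrFun h 1
  have h2 := congrFun h 2
  simp only [modScalar, Pi.smul_apply, Matrix.cons_val, smul_eq_mul] at h0 h1 h2
  have h0' : A 0 0 = A 1 1 + t * (B 0 0 - B 1 1) := by rw [← h0]; ring
  ext i j
  fin_cases i <;> fin_cases j <;> simp [Matrix.mul_apply, h1, h2, h0'] <;> ring

/-- The entries of `AB - BA` are, up to sign, the `2 × 2` minors of the two coordinate vectors. -/
theorem exists_modScalar_smul_of_commute {A B : Matrix (Fin 2) (Fin 2) F}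
    (hB : modScalar B ≠ 0) (h : A * B = B * A) :
    ∃ t : F, t • modScalar B = modScalar A := by
  have h00 := congrFun (congrFun h 0) 0
  have h01 := congrFun (congrFun h 0) 1
  have h10 := congrFun (congrFun h 1) 0
  simp only [Matrix.mul_apply, Fin.sum_univ_two] at h00 h01 h10
  have e1 : A 0 1 * B 1 0 = B 0 1 * A 1 0 := by linear_combination h00
  have e2 : (A 0 0 - A 1 1) * B 0 1 = (B 0 0 - B 1 1) * A 0 1 := by linear_combination h01
  have e3 : (A 0 0 - A 1 1) * B 1 0 = (B 0 0 - B 1 1) * A 1 0 := by linear_combination - h10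
  by_cases hx : B 0 0 - B 1 1 = 0
  · by_cases hy : B 0 1 = 0
    · by_cases hz : B 1 0 = 0
      · exact absurd (by ext i; fin_cases i <;> simp [modScalar, hx, hy, hz]) hB
      · refine ⟨A 1 0 / B 1 0, ?_⟩
        ext i
        fin_cases i <;> simp [modScalar] <;> field_simp <;>
          first | linear_combination -e3 | linear_combination -e1
    · refine ⟨A 0 1 / B 0 1, ?_⟩
      ext i
      fin_cases i <;> simp [modScalar] <;> field_simp <;>
        first | linear_combination -e2 | linear_combination e1
  · refine ⟨(A 0 0 - A 1 1) / (B 0 0 - B 1 1), ?_⟩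
    ext i
    fin_cases i <;> simp [modScalar] <;> field_simp <;>
      first | linear_combination e2 | linear_combination e3

/-- The colour may depend on the lift: one lift is fixed per group element. -/
theorem cliqueNum_le_card_of_coloring [Finite F] {κ : Type*} (T : Finset κ)
    (c : GL (Fin 2) F → κ) (hcT : ∀ A, modScalar A.val ≠ 0 → c A ∈ T)
    (hc : ∀ A B, modScalar A.val ≠ 0 → modScalar B.val ≠ 0 → c A = c B →
      SignCommute A.val B.val) :
    (nonCommutingGraph (ProjGenLinGroup (Fin 2) F)).cliqueNum ≤ T.card := by
  obtain ⟨s, hs⟩ := (nonCommutingGraph (ProjGenLinGroup (Fin 2) F)).exists_isNClique_cliqueNum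
  rw [← hs.card_eq]
  choose r hr using mk_surjective (n := Fin 2) (R := F)
  have hne : ∀ g : {g : ProjGenLinGroup (Fin 2) F // g ∉ Subgroup.center _},
      modScalar (r g).val ≠ 0 := fun g => modScalar_ne_zero (by rw [hr]; exact g.2)
  refine Finset.card_le_card_of_injOn (fun g => c (r g)) (fun g _ => hcT _ (hne g)) ?_
  intro g hg k hk hgk
  by_contra hn
  apply hs.isClique hg hk hn
  rw [← hr g.1, ← hr k.1]
  exact (mk_mul_comm_iff_signCommute _ _).mpr (hc _ _ (hne g) (hne k) hgk)

theorem card_le_cliqueNum_of_pairwise [Finite F] {ι : Type*} [Fintype ι] [Nontrivial ι]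
    (f : ι → GL (Fin 2) F) (hf : Pairwise fun i j => ¬ SignCommute (f i).val (f j).val) :
    Fintype.card ι ≤ (nonCommutingGraph (ProjGenLinGroup (Fin 2) F)).cliqueNum := by
  have hne : ∀ i j, i ≠ j → mk (f i) * mk (f j) ≠ mk (f j) * mk (f i) := fun i j hij h =>
    hf hij ((mk_mul_comm_iff_signCommute _ _).mp h)
  have hcen : ∀ i, mk (f i) ∉ Subgroup.center (ProjGenLinGroup (Fin 2) F) := by
    intro i hi
    obtain ⟨j, hj⟩ := exists_ne i
    exact hne j i hj (Subgroup.mem_center_iff.mp hi _)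
  have : Finite (ProjGenLinGroup (Fin 2) F) := Finite.of_surjective _ mk_surjective
  let v : ι ↪ {g : ProjGenLinGroup (Fin 2) F // g ∉ Subgroup.center _} :=
    ⟨fun i => ⟨mk (f i), hcen i⟩, fun i j hij => by
      by_contra hn
      apply hne i j hn
      rw [show mk (f i) = mk (f j) from congrArg Subtype.val hij]⟩
  have hcl : (nonCommutingGraph (ProjGenLinGroup (Fin 2) F)).IsClique
      (Finset.univ.map v : Finset _) := by
    intro a ha b hb hab
    simp only [Finset.coe_map, Finset.coe_univ, Set.image_univ, Set.mem_range] at ha hb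
    obtain ⟨i, rfl⟩ := ha
    obtain ⟨j, rfl⟩ := hb
    exact hne i j (fun h => hab (by rw [h]))
  simpa using SimpleGraph.IsClique.card_le_cliqueNum (tc := hcl)

theorem card_projectivization_fin_three [Finite F] :
    Nat.card (Projectivization F (Fin 3 → F)) = Nat.card F ^ 2 + Nat.card F + 1 := by
  rw [Projectivization.card_of_finrank F (Fin 3 → F) (n := 3) (by simp)]
  simp [Finset.sum_range_succ]
  ring

theorem cliqueNum_le_card_sq_add_card_add_one [Finite F] :
    (nonCommutingGraph (ProjGenLinGroup (Fin 2) F)).cliqueNum ≤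
      Nat.card F ^ 2 + Nat.card F + 1 := by
  classical
  have : Fintype (Projectivization F (Fin 3 → F)) := Fintype.ofFinite _
  rw [← card_projectivization_fin_three, Nat.card_eq_fintype_card]
  refine cliqueNum_le_card_of_coloring Finset.univ
    (fun A => if h : modScalar A.val ≠ 0 then Projectivization.mk F (modScalar A.val) h else
      Projectivization.mk F ![1, 0, 0] (by simp)) (fun _ _ => Finset.mem_univ _) ?_
  intro A B hA hB h
  simp only [hA, hB, ne_eq, not_false_eq_true, dite_true] at h
  obtain ⟨t, ht⟩ := (Projectivization.mk_eq_mk_iff' F _ _ hA hB).mp h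
  exact Or.inl (commute_of_modScalar_eq_smul t ht.symm)

theorem exists_modScalar_eq_det_ne_zero [Finite F] (hF : 3 < Nat.card F) (v : Fin 3 → F) :
    ∃ A : GL (Fin 2) F, modScalar A.val = v ∧ (A.val.trace ≠ 0 ∨ (2 : F) = 0) := by
  classical
  have : Fintype F := Fintype.ofFinite F
  open Polynomial in
  let p : F[X] := X ^ 2 + C (v 0) * X + C (-(v 1 * v 2))
  have hp : p.natDegree = 2 := by simp only [p]; compute_degree!
  have hp0 : p ≠ 0 := by intro h; simp [h] at hp
  -- Lifts of `v` differ by a scalar `t`: two values at most kill the determinant, one the trace. In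
  -- characteristic 2 the last is a harmless junk value.
  have hcard : (insert (-(v 0) / 2) p.roots.toFinset).card < (Finset.univ : Finset F).card := by
    have h1 := Finset.card_insert_le (-(v 0) / 2) p.roots.toFinset
    have h2 := p.roots.toFinset_card_le
    have h3 := p.card_roots'
    rw [Finset.card_univ, ← Nat.card_eq_fintype_card]
    lia
  obtain ⟨t, -, ht⟩ := Finset.exists_mem_notMem_of_card_lt_card hcard
  simp only [Finset.mem_insert, Multiset.mem_toFinset, Polynomial.mem_roots hp0, not_or] at ht
  have hdet : (!![t + v 0, v 1; v 2, t]).det ≠ 0 := by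
    intro h
    apply ht.2
    rw [Matrix.det_fin_two_of] at h
    simp only [Polynomial.IsRoot, p, Polynomial.eval_add, Polynomial.eval_mul,
      Polynomial.eval_pow, Polynomial.eval_X, Polynomial.eval_C]
    linear_combination h
  refine ⟨GeneralLinearGroup.mkOfDetNeZero _ hdet, ?_, ?_⟩
  · ext i
    fin_cases i <;> simp [modScalar, GeneralLinearGroup.mkOfDetNeZero]
  · by_cases h2 : (2 : F) = 0
    · exact Or.inr h2
    · left
      intro h
      apply ht.1
      simp only [GeneralLinearGroup.mkOfDetNeZero, GeneralLinearGroup.val_mk',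
        Matrix.trace_fin_two] at h
      rw [eq_div_iff h2]
      simp at h
      linear_combination h

/-- Anticommuting with `B` makes `A` conjugate to `-A`, so its trace vanishes unless `2 = 0`, where
signs are void. -/
theorem signCommute_iff_of_trace_ne_zero {A : Matrix (Fin 2) (Fin 2) F} {B : GL (Fin 2) F}
    (hA : A.trace ≠ 0 ∨ (2 : F) = 0) : SignCommute A B.val ↔ A * B.val = B.val * A := by
  refine ⟨?_, Or.inl⟩
  rintro (h | h)
  · exact h
  · have h2 : (2 : F) = 0 := by
      rcases hA with hA | hA
      · have ht : A.trace = -A.trace := by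
          calc A.trace = (A * B.val * B⁻¹.val).trace := by simp [mul_assoc]
            _ = -A.trace := by
              rw [h, neg_mul, trace_neg, trace_mul_comm, ← mul_assoc]
              simp
        refine (mul_eq_zero.mp ?_).resolve_right hA
        linear_combination ht
      · exact hA
    have : (-1 : F) = 1 := by linear_combination -h2
    rw [h, ← neg_one_smul F, this, one_smul]

theorem card_sq_add_card_add_one_le_cliqueNum [Finite F] (hF : 3 < Nat.card F) :
    Nat.card F ^ 2 + Nat.card F + 1 ≤
      (nonCommutingGraph (ProjGenLinGroup (Fin 2) F)).cliqueNum := by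
  classical
  have : Fintype (Projectivization F (Fin 3 → F)) := Fintype.ofFinite _
  have hc := card_projectivization_fin_three (F := F)
  choose r hr htr using exists_modScalar_eq_det_ne_zero hF
  rw [Nat.card_eq_fintype_card] at hc
  have : Nontrivial (Projectivization F (Fin 3 → F)) := by
    rw [← Fintype.one_lt_card_iff_nontrivial, hc]
    lia
  rw [← hc]
  refine card_le_cliqueNum_of_pairwise (fun P => r P.rep) ?_
  intro P Q hPQ h
  rw [signCommute_iff_of_trace_ne_zero (htr _)] at h
  apply hPQ
  rw [← P.mk_rep, ← Q.mk_rep, Projectivization.mk_eq_mk_iff']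
  simpa only [hr] using exists_modScalar_smul_of_commute 
    (by rw [hr]; exact Q.rep_nonzero) h

theorem signCommute_mapMatrix_iff {K : Type*} [Field K] (e : F ≃+* K)
    (A B : Matrix (Fin 2) (Fin 2) F) :
    SignCommute (e.mapMatrix A) (e.mapMatrix B) ↔ SignCommute A B := by
  simp only [SignCommute, ← map_mul, ← map_neg, EmbeddingLike.apply_eq_iff_eq]

/-- The clique number from a family of pairwise non-commuting matrices and a colouring with equally
many colours, both over an isomorphic field. -/
theorem cliqueNum_eq_of_ringEquiv [Finite F] {K κ ι : Type*} [Field K] [Fintype ι]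
    [Nontrivial ι] (e : F ≃+* K) (f : ι → Matrix (Fin 2) (Fin 2) K)
    (hfdet : ∀ i, (f i).det ≠ 0)
    (hf : ∀ i j, i ≠ j → ¬ SignCommute (f i) (f j))
    (T : Finset κ) (col : Matrix (Fin 2) (Fin 2) K → κ)
    (hT : ∀ A, A.det ≠ 0 → modScalar A ≠ 0 → col A ∈ T)
    (hcol : ∀ A B, A.det ≠ 0 → B.det ≠ 0 → modScalar A ≠ 0 → modScalar B ≠ 0 →
      col A = col B → SignCommute A B)
    (hcard : Fintype.card ι = T.card) :
    (nonCommutingGraph (ProjGenLinGroup (Fin 2) F)).cliqueNum = T.card := by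
  have hdet : ∀ A : GL (Fin 2) F, (e.mapMatrix A.val).det ≠ 0 := fun A => by
    rw [← RingEquiv.map_det]
    simpa using A.det_ne_zero
  have hms : ∀ A : Matrix (Fin 2) (Fin 2) F, modScalar A ≠ 0 →
      modScalar (e.mapMatrix A) ≠ 0 := fun A hA h => by
    apply hA
    ext i
    have hi := congrFun h i
    fin_cases i <;> simpa [modScalar, ← map_sub] using hi
  apply le_antisymm
  · refine cliqueNum_le_card_of_coloring T (fun A => col (e.mapMatrix A.val))
      (fun A hA => hT _ (hdet A) (hms _ hA)) ?_
    intro A B hA hB h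
    exact (signCommute_mapMatrix_iff e _ _).mp
      (hcol _ _ (hdet A) (hdet B) (hms _ hA) (hms _ hB) h)
  · rw [← hcard]
    refine card_le_cliqueNum_of_pairwise (fun i => GeneralLinearGroup.mkOfDetNeZero
      (e.symm.mapMatrix (f i)) (by rw [← RingEquiv.map_det]; simpa using hfdet i)) ?_
    intro i j hij
    exact fun h => hf i j hij ((signCommute_mapMatrix_iff e.symm _ _).mp h)

end General

/-! ### The fields with two and three elements -/

section Small

instance {F : Type*} [Field F] [DecidableEq F] (A B : Matrix (Fin 2) (Fin 2) F) :
    Decidable (SignCommute A B) :=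
  inferInstanceAs (Decidable (_ ∨ _))

theorem cliqueNum_pgl_of_card_eq_two {F : Type*} [Field F] [Finite F] (e : F ≃+* ZMod 2) :
    (nonCommutingGraph (ProjGenLinGroup (Fin 2) F)).cliqueNum = 4 := by
  refine cliqueNum_eq_of_ringEquiv e
    (![!![1, 1; 0, 1], !![1, 0; 1, 1], !![1, 1; 1, 0], !![0, 1; 1, 0]] :
      Fin 4 → Matrix (Fin 2) (Fin 2) (ZMod 2)) (by decide) (by decide)
    -- The missing points are split: invertible lifts would need two distinct nonzero eigenvalues.
    ({(0, 1, 0), (0, 0, 1), (1, 1, 1), (0, 1, 1)} : Finset (ZMod 2 × ZMod 2 × ZMod 2))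
    (fun A => (A 0 0 - A 1 1, A 0 1, A 1 0)) (by decide) ?_ rfl
  intro A B _ _ _ _ h
  simp only [Prod.mk.injEq] at h
  exact Or.inl (commute_of_modScalar_eq_smul 1 (by simp [modScalar, h]))

/-- A colouring of the coordinates of non-scalar matrices modulo scalars, up to sign: two split
tori that commute in `PGL(2, 3)` share a colour, while the other tori and the unipotent subgroups
have colours of their own. -/
def threeColor (x b c : ZMod 3) : ZMod 3 × ZMod 3 × ZMod 3 :=
  if x ^ 2 + b * c = 1 then
    if b = c then (1, 0, 0) else if x = b + c then (1, 1, 0) else (1, -1, 0)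
  else if x = 1 ∨ x = 0 ∧ (b = 1 ∨ b = 0 ∧ c = 1) then (x, b, c) else (-x, -b, -c)

theorem eq_or_perp_of_threeColor_eq : ∀ x b c x' b' c' : ZMod 3,
    threeColor x b c = threeColor x' b' c' → ¬(x = 0 ∧ b = 0 ∧ c = 0) →
    ¬(x' = 0 ∧ b' = 0 ∧ c' = 0) →
    (x = x' ∧ b = b' ∧ c = c') ∨ (x = -x' ∧ b = -b' ∧ c = -c') ∨
    (x ^ 2 + b * c = 1 ∧ x' ^ 2 + b' * c' = 1 ∧ b * c' + c * b' = x * x') := by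
  decide +kernel

/-- As `4 = 1`, the discriminant is 1; the eigenvalues are distinct and nonzero, hence `1` and `-1`.
-/
theorem eq_neg_of_split : ∀ a b c d : ZMod 3, a * d - b * c ≠ 0 →
    (a - d) ^ 2 + b * c = 1 → d = -a := by
  decide

theorem cliqueNum_pgl_of_card_eq_three {F : Type*} [Field F] [Finite F] (e : F ≃+* ZMod 3) :
    (nonCommutingGraph (ProjGenLinGroup (Fin 2) F)).cliqueNum = 10 := by
  refine cliqueNum_eq_of_ringEquiv e
    -- Three split matrices, one per commuting pair of tori; then four unipotent up to scalars and
    -- three nonsplit.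
    (![!![-1, 0; 0, 1], !![-1, 1; 0, 1], !![-1, -1; 0, 1], !![1, 0; 1, 1], !![1, 1; 0, 1],
      !![1, 1; -1, 0], !![1, -1; 1, 0], !![1, 1; -1, 1], !![1, 1; 1, 0], !![1, -1; -1, 0]] :
      Fin 10 → Matrix (Fin 2) (Fin 2) (ZMod 3)) (by decide) (by decide)
    ({(1, 0, 0), (1, 1, 0), (1, -1, 0), (0, 0, 1), (0, 1, 0), (1, 1, -1), (1, -1, 1), (0, 1, -1),
      (1, 1, 1), (1, -1, -1)} : Finset (ZMod 3 × ZMod 3 × ZMod 3))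
    (fun A => threeColor (A 0 0 - A 1 1) (A 0 1) (A 1 0)) ?_ ?_ rfl
  · have key : ∀ x b c : ZMod 3, ¬(x = 0 ∧ b = 0 ∧ c = 0) → threeColor x b c ∈
        ({(1, 0, 0), (1, 1, 0), (1, -1, 0), (0, 0, 1), (0, 1, 0), (1, 1, -1), (1, -1, 1),
          (0, 1, -1), (1, 1, 1), (1, -1, -1)} : Finset (ZMod 3 × ZMod 3 × ZMod 3)) := by
      decide
    intro A _ hA
    exact key _ _ _ fun h => hA (by simp [modScalar, h])
  · intro A B hA hB hA' hB' h
    rcases eq_or_perp_of_threeColor_eq _ _ _ _ _ _ h (fun h => hA' (by simp [modScalar, h]))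
      (fun h => hB' (by simp [modScalar, h])) with h | h | ⟨h1, h2, h3⟩
    · exact Or.inl (commute_of_modScalar_eq_smul 1 (by simp [modScalar, h]))
    · exact Or.inl (commute_of_modScalar_eq_smul (-1) (by simp [modScalar, h]))
    -- For traceless matrices `AB + BA = tr(AB) • 1`, and modulo 3 `h3` says `tr(AB) = 0`.
    · rw [det_fin_two] at hA hB
      have tA := eq_neg_of_split _ _ _ _ hA h1
      have tB := eq_neg_of_split _ _ _ _ hB h2
      rw [tA, tB] at h3
      have three : (3 : ZMod 3) = 0 := rfl
      right
      ext i j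
      fin_cases i <;> fin_cases j <;> simp [Matrix.mul_apply, tA, tB]
      · linear_combination h3 + 2 * A 0 0 * B 0 0 * three
      · ring
      · ring
      · linear_combination h3 + 2 * A 0 0 * B 0 0 * three

end Small

theorem mainTheorem7 {F : Type*} [Field F] [Finite F] (q : ℕ) (hq : Nat.card F = q) :
    (q = 2 →
      (nonCommutingGraph (Matrix.ProjGenLinGroup (Fin 2) F)).cliqueNum = 4) ∧
    (q = 3 →
      (nonCommutingGraph (Matrix.ProjGenLinGroup (Fin 2) F)).cliqueNum = 10) ∧
    (3 < q →
      (nonCommutingGraph (Matrix.ProjGenLinGroup (Fin 2) F)).cliqueNum =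
        q ^ 2 + q + 1) := by
  have : Fintype F := Fintype.ofFinite F
  refine ⟨fun h => ?_, fun h => ?_, fun h => ?_⟩
  · rw [Nat.card_eq_fintype_card] at hq
    exact cliqueNum_pgl_of_card_eq_two
      (ZMod.ringEquivOfPrime F Nat.prime_two (hq.trans h)).symm
  · rw [Nat.card_eq_fintype_card] at hq
    exact cliqueNum_pgl_of_card_eq_three
      (ZMod.ringEquivOfPrime F Nat.prime_three (hq.trans h)).symm
  · rw [← hq] at h ⊢
    exact le_antisymm cliqueNum_le_card_sq_add_card_add_one
      (card_sq_add_card_add_one_le_cliqueNum h)
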